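/- Let $G\subseteq GL(n,\mathbb R)$ be an $N$-dimensional matrix Lie group, let $E_1,\dots,E_N$ be a basis of its Lie algebra $\mathcal G=\{X:\exp(tX)\in G\ \text{for all } t\in\mathbb R\}$, write $x^\wedge=\sum_i x_iE_i$ for $x\in\mathbb R^N$, let $^\vee$ be the inverse of $^\wedge$, and abbreviate $\exp(x)=\exp(x^\wedge)$. Let $$J_l(x)=\Big[\big(\tfrac{\partial \exp(x)}{\partial x_1}\exp(x)^{-1}\big)^\vee,\dots,\big(\tfrac{\partial \exp(x)}{\partial x_N}\exp(x)^{-1}\big)^\vee\Big]$$ be the left Jacobian. Let $D\subseteq\mathbb R^N$ be a domain of exponential coordinates, i.e. an open set containing $0$ on which $\exp$ is injective and $J_l$ is nonsingular, and let $\log^\vee:\exp(D)\to D$ be the inverse of $\exp|_D$. For a $G$-valued random variable $g$, a group-theoretic mean is an element $\mu_m\in G$ such that $\mu_m^{-1}g\in\exp(D)$ almost surely, $\log^\vee(\mu_m^{-1}g)$ is integrable, and $\mathbb E[\log^\vee(\mu_m^{-1}g)]=0$; the covariance is then $\Sigma_m=\mathbb E\big[\log^\vee(\mu_m^{-1}g)\,\log^\vee(\mu_m^{-1}g)^T\big]$.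 Put $\mathrm{sym}(A)=A+A^T$. Vectors carry the Euclidean norm and matrices the spectral norm. **Theorem.** For every compact $K\subseteq D$ there are constants $\delta,r,C>0$ such that the following holds for every $\mu\in G$ and every random vector $x$ that takes values in $K$ almost surely (for example, one with a probability density $\tilde p$ supported in $K$) and whose mean $m=\mathbb E(x)$ and covariance matrix $\Sigma$ satisfy $\|m\|\le\delta$ and $\|\Sigma\|\le\delta$. Write $\langle v\rangle=\mathbb E[v(x)]$ and $g=\mu\exp(x)$. The matrix $J_l^{-1}(x)$ is integrable and $\langle J_l^{-1}\rangle$ is invertible, so that $m'=\langle J_l^{-1}\rangle^{-1}m$ is defined, and $J_l^{-1}(x)\,m'x^T$ is integrable. There is exactly one $\varepsilon\in\mathbb R^N$ with $\|\varepsilon\|<r$ such that $\mu_m=\mu\exp(\varepsilon)$ is a group-theoretic mean of $g$. For this $\varepsilon$, $$\|\varepsilon-m'\|\le C\|m'\|^2,\qquad\text{i.e. } \mu_m=\mu\exp\big(m'+O(|m'|^2)\big).$$ The covariance $\Sigma_m$ of $g$ is finite (its integrand is integrable) and $$\Big\|\Sigma_m-\Big(\Sigma-\mathrm{sym}\big(\langle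 J_l^{-1}m'x^T\rangle\big)\Big)\Big\|\le C\|m'\|^2 .$$ -/

import Mathlib

open MeasureTheory
open scoped Matrix Matrix.Norms.L2Operator

noncomputable section

/-- The exponential of a real square matrix, as an element of the general linear group. -/
def expGL {n : ℕ} (X : Matrix (Fin n) (Fin n) ℝ) : GL (Fin n) ℝ where
  val := NormedSpace.exp X
  inv := NormedSpace.exp (-X)
  val_inv := by
    rw [← Matrix.exp_add_of_commute _ _ (Commute.neg_right (Commute.refl X))]; simp
  inv_val := by
    rw [← Matrix.exp_add_of_commute _ _ (Commute.neg_left (Commute.refl X))]; simp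

/-- The Lie algebra of a matrix group: the matrices whose one-parameter group lies in it. -/
def matrixLieAlgebra {n : ℕ} (G : Subgroup (GL (Fin n) ℝ)) :
    Set (Matrix (Fin n) (Fin n) ℝ) :=
  {X | ∀ t : ℝ, expGL (t • X) ∈ G}

/-- An `N`-dimensional matrix Lie group in `GL(n, ℝ)` together with a basis `E` of its Lie algebra.
Every closed, and every connected immersed, Lie subgroup of `GL(n, ℝ)` is of this form; closedness
of the subgroup is not required. -/
structure MatrixLieGroup (n N : ℕ) where
  carrier : Subgroup (GL (Fin n) ℝ)
  E : Fin N → Matrix (Fin n) (Fin n) ℝ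
  linearIndependent : LinearIndependent ℝ E
  span_eq : (Submodule.span ℝ (Set.range E) : Set (Matrix (Fin n) (Fin n) ℝ)) =
    matrixLieAlgebra carrier

/-- The outer product `a bᵀ` of two vectors. -/
def outer {N : ℕ} (a b : EuclideanSpace ℝ (Fin N)) : Matrix (Fin N) (Fin N) ℝ :=
  Matrix.of fun i j => a i * b j

/-- `sym(A) = A + Aᵀ`. -/
def symPart {N : ℕ} (A : Matrix (Fin N) (Fin N) ℝ) : Matrix (Fin N) (Fin N) ℝ := A + Aᵀ

/-- The mean `𝔼(x)` of a random vector. -/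
def meanVec {N : ℕ} {Ω : Type*} [MeasurableSpace Ω] (P : Measure Ω)
    (x : Ω → EuclideanSpace ℝ (Fin N)) : EuclideanSpace ℝ (Fin N) :=
  ∫ ω, x ω ∂P

/-- The covariance matrix `𝔼((x - 𝔼 x)(x - 𝔼 x)ᵀ)` of a random vector. -/
def covMatrix {N : ℕ} {Ω : Type*} [MeasurableSpace Ω] (P : Measure Ω)
    (x : Ω → EuclideanSpace ℝ (Fin N)) : Matrix (Fin N) (Fin N) ℝ :=
  ∫ ω, outer (x ω - meanVec P x) (x ω - meanVec P x) ∂P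

/-- A random vector whose law is carried by `K` and whose mean and covariance matrix have Euclidean
norm, respectively spectral norm, at most `δ`. -/
structure IsConcentrated {N : ℕ} {Ω : Type*} [MeasurableSpace Ω]
    (K : Set (EuclideanSpace ℝ (Fin N))) (δ : ℝ) (P : Measure Ω)
    (x : Ω → EuclideanSpace ℝ (Fin N)) : Prop where
  aemeasurable : AEMeasurable x P
  ae_mem : ∀ᵐ ω ∂P, x ω ∈ K
  norm_mean_le : ‖meanVec P x‖ ≤ δ
  norm_cov_le : ‖covMatrix P x‖ ≤ δ

namespace MatrixLieGroup

variable {n N : ℕ} (G : MatrixLieGroup n N)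

/-- The linear map `x ↦ x^∧ = ∑ xᵢ Eᵢ` from `ℝᴺ` onto the Lie algebra. -/
def wedge (x : EuclideanSpace ℝ (Fin N)) : Matrix (Fin n) (Fin n) ℝ := ∑ i, x i • G.E i

/-- The inverse of `wedge` on the Lie algebra (a junk value elsewhere). -/
def vee (X : Matrix (Fin n) (Fin n) ℝ) : EuclideanSpace ℝ (Fin N) := Function.invFun G.wedge X

theorem expGL_wedge_mem (x : EuclideanSpace ℝ (Fin N)) : expGL (G.wedge x) ∈ G.carrier := by
  have h : G.wedge x ∈ (Submodule.span ℝ (Set.range G.E) : Set (Matrix (Fin n) (Fin n) ℝ)) :=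
    Submodule.sum_mem _ fun i _ => Submodule.smul_mem _ _ (Submodule.subset_span ⟨i, rfl⟩)
  rw [G.span_eq] at h
  simpa using h 1

/-- The exponential coordinates `x ↦ exp(x^∧)` with values in the group. -/
def Exp (x : EuclideanSpace ℝ (Fin N)) : G.carrier := ⟨expGL (G.wedge x), G.expGL_wedge_mem x⟩

/-- The left Jacobian of the exponential coordinates: column `j` is `((∂g/∂qⱼ) g⁻¹)^∨` for
`g(q) = exp(q^∧)`. -/
def leftJac (q : EuclideanSpace ℝ (Fin N)) : Matrix (Fin N) (Fin N) ℝ :=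
  Matrix.of fun i j =>
    G.vee (fderiv ℝ (fun p => NormedSpace.exp (G.wedge p)) q (EuclideanSpace.single j 1) *
      NormedSpace.exp (-G.wedge q)) i

/-- `D` is a domain of exponential coordinates: an open neighbourhood of the origin on which the
exponential is injective and a local diffeomorphism (its Jacobian is nonsingular). -/
structure IsExpDomain (D : Set (EuclideanSpace ℝ (Fin N))) : Prop where
  isOpen : IsOpen D
  zero_mem : 0 ∈ D
  injOn : Set.InjOn G.Exp D
  isUnit_leftJac : ∀ q ∈ D, IsUnit (G.leftJac q)

/-- The logarithm `log^∨ : exp(D) → D`, inverse to the exponential on `D` (a junk value off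
`exp(D)`). -/
def log (D : Set (EuclideanSpace ℝ (Fin N))) (g : G.carrier) : EuclideanSpace ℝ (Fin N) :=
  Function.invFunOn G.Exp D g

/-- `a` is a group-theoretic mean of the random group element `g`:
`log^∨(a⁻¹ g)` is almost surely defined, integrable, and has expectation zero. -/
structure IsGroupMean {Ω : Type*} [MeasurableSpace Ω] (D : Set (EuclideanSpace ℝ (Fin N)))
    (P : Measure Ω) (g : Ω → G.carrier) (a : G.carrier) : Prop where
  ae_mem : ∀ᵐ ω ∂P, a⁻¹ * g ω ∈ G.Exp '' D
  integrable : Integrable (fun ω => G.log D (a⁻¹ * g ω)) P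
  integral_eq_zero : ∫ ω, G.log D (a⁻¹ * g ω) ∂P = 0

/-- The covariance `𝔼(log^∨(a⁻¹ g) log^∨(a⁻¹ g)ᵀ)` of the random group element `g` about `a`. -/
def groupCov {Ω : Type*} [MeasurableSpace Ω] (D : Set (EuclideanSpace ℝ (Fin N)))
    (P : Measure Ω) (g : Ω → G.carrier) (a : G.carrier) : Matrix (Fin N) (Fin N) ℝ :=
  ∫ ω, outer (G.log D (a⁻¹ * g ω)) (G.log D (a⁻¹ * g ω)) ∂P

/-- The matrix `⟨J_l⁻¹⟩ = 𝔼(J_l(x)⁻¹)`. -/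
def meanInvJac {Ω : Type*} [MeasurableSpace Ω] (P : Measure Ω)
    (x : Ω → EuclideanSpace ℝ (Fin N)) : Matrix (Fin N) (Fin N) ℝ :=
  ∫ ω, (G.leftJac (x ω))⁻¹ ∂P

/-- The corrected mean `m' = ⟨J_l⁻¹⟩⁻¹ m`. -/
def correctedMean {Ω : Type*} [MeasurableSpace Ω] (P : Measure Ω)
    (x : Ω → EuclideanSpace ℝ (Fin N)) : EuclideanSpace ℝ (Fin N) :=
  Matrix.toEuclideanLin (G.meanInvJac P x)⁻¹ (meanVec P x)

/-- The random matrix `J_l(x)⁻¹ m' xᵀ` at a sample point, as a function of `x` and `m'`. -/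
def crossTerm (m' x : EuclideanSpace ℝ (Fin N)) : Matrix (Fin N) (Fin N) ℝ :=
  outer (Matrix.toEuclideanLin (G.leftJac x)⁻¹ m') x

end MatrixLieGroup

end

/-!
Let `J = J_l` be the left Jacobian. The argument reduces the group-theoretic mean to the zero of a
map on `ℝᴺ` that is affine up to a quadratic remainder.

The Lie algebra of the group is a linear space by assumption and is stable under conjugation by its
own one-parameter groups, so by Duhamel's formula `∂(exp q^∧) · v = (J(q) v)^∧ exp q^∧`
(`MatrixLieGroup.fderiv_exp_wedge_eq`). Hence, if `y' = -J(y)⁻¹ ε` and `y 0 = x`, the product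
`exp(t ε) exp(y t)` is constant in `t`, and `φ ε x = y 1` is the logarithm of `exp(ε)⁻¹ exp(x)`
(`MatrixLieGroup.Exp_trajectory_eq`). This needs neither closedness of the group nor the
Baker–Campbell–Hausdorff series. Replacing `J⁻¹` away from the compact set by a globally bounded and
Lipschitz map makes all trajectories exist up to time `1`, and Grönwall's inequality gives
`φ ε x = x - J(x)⁻¹ ε + O(‖ε‖²)` together with a matching bound on the increments in `ε` of the
remainder (`IsTrajectory.norm_sub_add_le`).

Taking expectations, `μ exp(ε)` is a mean of `g` if and only if `f ε = 0`, where
`f ε = 𝔼 (φ ε x) = m - ⟨J⁻¹⟩ ε + O(‖ε‖²)`. Because `J(0) = 1` and the mean and covariance of `x` are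
small, `⟨J⁻¹⟩` is within `1 / 2` of the identity, so it is invertible and
`ε ↦ ε + ⟨J⁻¹⟩⁻¹ f ε` is a contraction near the origin; its fixed point is `m' + O(‖m'‖²)`
(`existsUnique_zero_of_quadratic_remainder`). Substituting `φ ε x = x - J(x)⁻¹ m' + O(‖m'‖²)` into
the second moment, and using `𝔼 (x xᵀ) = Σ + m mᵀ` with `m mᵀ = O(‖m'‖²)`, yields the covariance
(`IsLogExpansion.norm_integral_outer_sub_le`).
-/

noncomputable section

/-! ### The Lie algebra and the left Jacobian -/

theorem contDiff_matrix_exp {n : ℕ} {k : WithTop ℕ∞} :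
    ContDiff ℝ k (NormedSpace.exp : Matrix (Fin n) (Fin n) ℝ → Matrix (Fin n) (Fin n) ℝ) :=
  AnalyticOnNhd.contDiff fun X _ => NormedSpace.exp_analytic (𝕂 := ℝ) X

theorem continuous_matrix_exp {n : ℕ} :
    Continuous (NormedSpace.exp : Matrix (Fin n) (Fin n) ℝ → Matrix (Fin n) (Fin n) ℝ) :=
  contDiff_matrix_exp (k := 0) |>.continuous

theorem matrix_exp_neg_mul_exp {n : ℕ} (X : Matrix (Fin n) (Fin n) ℝ) :
    NormedSpace.exp (-X) * NormedSpace.exp X = 1 := (expGL X).inv_mul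

/-- The Lie algebra is stable under the adjoint action of the one-parameter groups it generates. -/
theorem exp_mul_mul_exp_neg_mem_matrixLieAlgebra {n : ℕ} {H : Subgroup (GL (Fin n) ℝ)}
    {X Y : Matrix (Fin n) (Fin n) ℝ} (hX : X ∈ matrixLieAlgebra H) (hY : Y ∈ matrixLieAlgebra H)
    (s : ℝ) :
    NormedSpace.exp (s • X) * Y * NormedSpace.exp (-(s • X)) ∈ matrixLieAlgebra H := by
  intro t
  have h := H.mul_mem (H.mul_mem (hX s) (hY t)) (H.inv_mem (hX s))
  convert h using 1
  ext1
  have e := Matrix.exp_units_conj (expGL (s • X)) (t • Y)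
  simpa [expGL, mul_smul_comm, smul_mul_assoc] using e

/-- Duhamel's formula for a finite increment. -/
theorem exp_mul_exp_neg_sub_one_eq_integral {n : ℕ} (A B : Matrix (Fin n) (Fin n) ℝ) :
    NormedSpace.exp B * NormedSpace.exp (-A) - 1 =
      ∫ s in (0 : ℝ)..1, NormedSpace.exp (s • B) * (B - A) * NormedSpace.exp (-(s • A)) := by
  have hd : ∀ s ∈ Set.uIcc (0 : ℝ) 1,
      HasDerivAt (fun s : ℝ => NormedSpace.exp (s • B) * NormedSpace.exp (s • (-A)))
      (NormedSpace.exp (s • B) * (B - A) * NormedSpace.exp (-(s • A))) s := by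
    intro s _
    have h := (hasDerivAt_exp_smul_const (𝕂 := ℝ) B s).mul
      (hasDerivAt_exp_smul_const' (𝕂 := ℝ) (-A) s)
    refine h.congr_deriv ?_
    rw [smul_neg]
    noncomm_ring
  have hc : Continuous fun s : ℝ =>
      NormedSpace.exp (s • B) * (B - A) * NormedSpace.exp (-(s • A)) := by
    have := @continuous_matrix_exp n
    fun_prop
  rw [intervalIntegral.integral_eq_sub_of_hasDerivAt hd (hc.intervalIntegrable _ _)]
  simp

/-- The derivative of the exponential, trivialized by right translation. -/
theorem fderiv_exp_mul_exp_neg {n : ℕ} (X Y : Matrix (Fin n) (Fin n) ℝ) :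
    fderiv ℝ NormedSpace.exp X Y * NormedSpace.exp (-X) =
      ∫ s in (0 : ℝ)..1, NormedSpace.exp (s • X) * Y * NormedSpace.exp (-(s • X)) := by
  have hE := @continuous_matrix_exp n
  set F : ℝ → Matrix (Fin n) (Fin n) ℝ := fun h =>
    ∫ s in (0 : ℝ)..1, NormedSpace.exp (s • (X + h • Y)) * Y * NormedSpace.exp (-(s • X)) with hF
  have hFc : Continuous F := by
    apply intervalIntegral.continuous_parametric_intervalIntegral_of_continuous'
    simp only [Function.uncurry_def]
    fun_prop
  have h1 : ∀ h : ℝ, NormedSpace.exp (X + h • Y) * NormedSpace.exp (-X) = 1 + h • F h := by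
    intro h
    have := exp_mul_exp_neg_sub_one_eq_integral X (X + h • Y)
    rw [sub_eq_iff_eq_add'] at this
    rw [this, hF, ← intervalIntegral.integral_smul]
    simp
  have h2 : HasDerivAt (fun h : ℝ => NormedSpace.exp (X + h • Y) * NormedSpace.exp (-X))
      (F 0) 0 := by
    simp only [h1]
    rw [hasDerivAt_iff_tendsto_slope]
    refine (hFc.tendsto 0 |>.mono_left nhdsWithin_le_nhds).congr' ?_
    filter_upwards [self_mem_nhdsWithin] with h hh
    have : h ≠ 0 := hh
    simp [slope, smul_smul, this]
  have h3 : HasDerivAt (fun h : ℝ => NormedSpace.exp (X + h • Y) * NormedSpace.exp (-X))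
      (fderiv ℝ NormedSpace.exp X Y * NormedSpace.exp (-X)) 0 := by
    have hl : HasDerivAt (fun h : ℝ => X + h • Y) Y 0 := by
      simpa using ((hasDerivAt_id (0 : ℝ)).smul_const Y).const_add X
    have hx : HasFDerivAt NormedSpace.exp (fderiv ℝ NormedSpace.exp X) (X + (0 : ℝ) • Y) := by
      simpa using ((contDiff_matrix_exp (k := 1)).differentiable one_ne_zero X).hasFDerivAt
    exact (hx.comp_hasDerivAt 0 hl).mul_const _
  rw [h3.unique h2, hF]
  simp

namespace MatrixLieGroup

variable {n N : ℕ} (G : MatrixLieGroup n N)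

/-- The map `x ↦ x^∧` as a continuous linear map. -/
def wedgeCLM : EuclideanSpace ℝ (Fin N) →L[ℝ] Matrix (Fin n) (Fin n) ℝ :=
  LinearMap.toContinuousLinearMap
    { toFun := G.wedge
      map_add' := fun x y => by simp [wedge, add_smul, Finset.sum_add_distrib]
      map_smul' := fun c x => by simp [wedge, mul_smul, Finset.smul_sum] }

@[simp] theorem wedgeCLM_apply (x : EuclideanSpace ℝ (Fin N)) : G.wedgeCLM x = G.wedge x := rfl

theorem wedge_injective : Function.Injective G.wedge := by
  intro x y h
  have h0 : ∑ i, (x i - y i) • G.E i = 0 := by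
    simpa [wedge, sub_smul, sub_eq_zero] using h
  ext i
  exact sub_eq_zero.1 (Fintype.linearIndependent_iff.1 G.linearIndependent _ h0 i)

@[simp] theorem vee_wedge (x : EuclideanSpace ℝ (Fin N)) : G.vee (G.wedge x) = x :=
  Function.leftInverse_invFun G.wedge_injective x

theorem range_wedge : Set.range G.wedge = matrixLieAlgebra G.carrier := by
  rw [← G.span_eq]
  ext X
  simp only [Set.mem_range, SetLike.mem_coe, Submodule.mem_span_range_iff_exists_fun]
  constructor
  · rintro ⟨x, rfl⟩
    exact ⟨fun i => x i, rfl⟩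
  · rintro ⟨c, rfl⟩
    exact ⟨WithLp.toLp 2 c, rfl⟩

theorem exists_leftInverse_wedge :
    ∃ V : Matrix (Fin n) (Fin n) ℝ →L[ℝ] EuclideanSpace ℝ (Fin N), ∀ x, V (G.wedge x) = x := by
  obtain ⟨V, hV⟩ := G.wedgeCLM.toLinearMap.exists_leftInverse_of_injective
    (LinearMap.ker_eq_bot.2 G.wedge_injective)
  exact ⟨LinearMap.toContinuousLinearMap V, fun x => LinearMap.congr_fun hV x⟩

/-- A linear left inverse of `x ↦ x^∧` on all matrices. Unlike `vee`, it is continuous. -/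
def veeCLM : Matrix (Fin n) (Fin n) ℝ →L[ℝ] EuclideanSpace ℝ (Fin N) :=
  G.exists_leftInverse_wedge.choose

@[simp] theorem veeCLM_wedge (x : EuclideanSpace ℝ (Fin N)) : G.veeCLM (G.wedge x) = x :=
  G.exists_leftInverse_wedge.choose_spec x

theorem contDiff_exp_wedge {k : WithTop ℕ∞} :
    ContDiff ℝ k fun p => NormedSpace.exp (G.wedge p) :=
  contDiff_matrix_exp.comp G.wedgeCLM.contDiff

theorem fderiv_exp_wedge (q v : EuclideanSpace ℝ (Fin N)) :
    fderiv ℝ (fun p => NormedSpace.exp (G.wedge p)) q v =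
      fderiv ℝ NormedSpace.exp (G.wedge q) (G.wedge v) := by
  have h : HasFDerivAt (NormedSpace.exp ∘ G.wedgeCLM)
      ((fderiv ℝ NormedSpace.exp (G.wedge q)).comp G.wedgeCLM) q :=
    ((contDiff_matrix_exp (k := 1)).differentiable one_ne_zero _).hasFDerivAt.comp q
      G.wedgeCLM.hasFDerivAt
  exact DFunLike.congr_fun h.fderiv v

/-- The logarithmic derivative of the exponential coordinates takes values in the Lie algebra: it
is an average of conjugates of `v^∧` by elements of a one-parameter group. -/
theorem fderiv_exp_wedge_mul_mem_range (q v : EuclideanSpace ℝ (Fin N)) :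
    fderiv ℝ (fun p => NormedSpace.exp (G.wedge p)) q v * NormedSpace.exp (-G.wedge q) ∈
      Set.range G.wedge := by
  have hE := @continuous_matrix_exp n
  rw [fderiv_exp_wedge, fderiv_exp_mul_exp_neg]
  set c : ℝ → Matrix (Fin n) (Fin n) ℝ := fun s =>
    NormedSpace.exp (s • G.wedge q) * G.wedge v * NormedSpace.exp (-(s • G.wedge q))
  have hc : ∀ s, c s = G.wedgeCLM (G.veeCLM (c s)) := by
    intro s
    have hm : c s ∈ Set.range G.wedge := by
      rw [range_wedge]
      apply exp_mul_mul_exp_neg_mem_matrixLieAlgebra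
      · rw [← range_wedge]; exact ⟨q, rfl⟩
      · rw [← range_wedge]; exact ⟨v, rfl⟩
    obtain ⟨y, hy⟩ := hm
    rw [← hy]; simp
  have hcc : Continuous fun s => G.veeCLM (c s) := by fun_prop
  refine ⟨∫ s in (0 : ℝ)..1, G.veeCLM (c s), ?_⟩
  rw [← wedgeCLM_apply, ← ContinuousLinearMap.intervalIntegral_comp_comm _
    (hcc.intervalIntegrable _ _)]
  simp only [← hc]

theorem leftJac_apply (q : EuclideanSpace ℝ (Fin N)) (i j : Fin N) :
    G.leftJac q i j = G.veeCLM (fderiv ℝ (fun p => NormedSpace.exp (G.wedge p)) q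
      (EuclideanSpace.single j 1) * NormedSpace.exp (-G.wedge q)) i := by
  obtain ⟨y, hy⟩ := G.fderiv_exp_wedge_mul_mem_range q (EuclideanSpace.single j 1)
  simp [leftJac, ← hy]

theorem toEuclideanLin_leftJac (q v : EuclideanSpace ℝ (Fin N)) :
    Matrix.toEuclideanLin (G.leftJac q) v =
      G.veeCLM (fderiv ℝ (fun p => NormedSpace.exp (G.wedge p)) q v *
        NormedSpace.exp (-G.wedge q)) := by
  have hv : v = ∑ j, v j • EuclideanSpace.single j (1 : ℝ) := by
    simpa using ((EuclideanSpace.basisFun (Fin N) ℝ).sum_repr v).symm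
  conv_rhs => rw [hv]
  ext i
  simp only [map_sum, map_smul, Finset.sum_mul, smul_mul_assoc]
  simp [Matrix.toEuclideanLin, Matrix.mulVec, dotProduct, leftJac_apply, mul_comm]

/-- The defining property of the left Jacobian: `d(exp q^∧)(v) = (J_l(q) v)^∧ exp q^∧`. -/
theorem fderiv_exp_wedge_eq (q v : EuclideanSpace ℝ (Fin N)) :
    fderiv ℝ (fun p => NormedSpace.exp (G.wedge p)) q v =
      G.wedge (Matrix.toEuclideanLin (G.leftJac q) v) * NormedSpace.exp (G.wedge q) := by
  obtain ⟨y, hy⟩ := G.fderiv_exp_wedge_mul_mem_range q v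
  rw [toEuclideanLin_leftJac, ← hy, veeCLM_wedge, hy, mul_assoc, matrix_exp_neg_mul_exp, mul_one]

theorem leftJac_zero : G.leftJac 0 = 1 := by
  have h0 : G.wedge 0 = 0 := G.wedgeCLM.map_zero
  ext i j
  rw [leftJac_apply, fderiv_exp_wedge, h0, (hasFDerivAt_exp_zero (𝕂 := ℝ)).fderiv]
  simp [Matrix.one_apply]

theorem contDiff_leftJac : ContDiff ℝ 1 G.leftJac := by
  have h : G.leftJac = fun q => ∑ i, ∑ j, G.leftJac q i j • Matrix.single i j (1 : ℝ) := by
    funext q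
    conv_lhs => rw [Matrix.matrix_eq_sum_single (G.leftJac q)]
    simp [Matrix.smul_single]
  rw [h]
  refine ContDiff.sum fun i _ => ContDiff.sum fun j _ => ?_
  suffices hij : ContDiff ℝ 1 fun q => G.leftJac q i j from hij.smul contDiff_const
  simp only [leftJac_apply]
  have h1 : ContDiff ℝ 1 fun q => fderiv ℝ (fun p => NormedSpace.exp (G.wedge p)) q
      (EuclideanSpace.single j 1) :=
    ((G.contDiff_exp_wedge (k := 2)).fderiv_right (m := 1) (by norm_num)).clm_apply contDiff_const
  have h2 : ContDiff ℝ 1 fun q => NormedSpace.exp (-G.wedge q) :=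
    contDiff_matrix_exp.comp G.wedgeCLM.contDiff.neg
  exact (EuclideanSpace.proj (𝕜 := ℝ) i : EuclideanSpace ℝ (Fin N) →L[ℝ] ℝ).contDiff.comp
    (G.veeCLM.contDiff.comp (h1.mul h2))

theorem contDiffAt_leftJac_inv {q : EuclideanSpace ℝ (Fin N)} (hq : IsUnit (G.leftJac q)) :
    ContDiffAt ℝ 1 (fun p => (G.leftJac p)⁻¹) q := by
  simp only [Matrix.nonsing_inv_eq_ringInverse]
  obtain ⟨u, hu⟩ := hq
  have h := contDiffAt_ringInverse ℝ (n := 1) u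
  rw [hu] at h
  exact h.comp q G.contDiff_leftJac.contDiffAt

end MatrixLieGroup

/-! ### Extension of a smooth map from a neighbourhood of a compact set -/

/-- A `C¹` map on an open set agrees near a compact subset with a globally bounded and Lipschitz
map. -/
theorem exists_bounded_lipschitz_eqOn_cthickening {E F : Type*} [NormedAddCommGroup E]
    [NormedSpace ℝ E] [FiniteDimensional ℝ E] [NormedAddCommGroup F] [NormedSpace ℝ F]
    {f : E → F} {K D : Set E} (hK : IsCompact K) (hD : IsOpen D) (hKD : K ⊆ D)
    (hf : ∀ x ∈ D, ContDiffAt ℝ 1 f x) :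
    ∃ (g : E → F) (M L : NNReal) (ρ : ℝ), 0 < ρ ∧ Metric.cthickening ρ K ⊆ D ∧
      Set.EqOn g f (Metric.cthickening ρ K) ∧ (∀ x, ‖g x‖ ≤ M) ∧ LipschitzWith L g := by
  have : ProperSpace E := FiniteDimensional.proper_real E
  obtain ⟨ρ, hρ, hρD⟩ := hK.exists_cthickening_subset_open hD hKD
  have hK1 : IsCompact (Metric.cthickening ρ K) := hK.cthickening
  obtain ⟨K2, hK2, h12, h2D⟩ := exists_compact_between hK1 hD hρD
  obtain ⟨χ, hχ1, hχ0, -⟩ := exists_contMDiffMap_one_nhds_of_subset_interior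
    (modelWithCornersSelf ℝ E) (n := 1) hK1.isClosed h12
  have hχ : ContDiff ℝ 1 (χ : E → ℝ) := χ.contMDiff.contDiff
  have hsupp : ∀ x ∉ K2, χ x • f x = 0 := fun x hx => by simp [hχ0 x hx]
  have hcs : HasCompactSupport fun x => χ x • f x := HasCompactSupport.intro hK2 hsupp
  have hcd : ContDiff ℝ 1 fun x => χ x • f x := by
    rw [contDiff_iff_contDiffAt]
    intro x
    by_cases hx : x ∈ D
    · exact hχ.contDiffAt.smul (hf x hx)
    · have hx2 : x ∈ K2ᶜ := fun h => hx (h2D h)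
      refine (contDiffAt_const (c := (0 : F))).congr_of_eventuallyEq ?_
      filter_upwards [hK2.isClosed.isOpen_compl.mem_nhds hx2] with y hy using hsupp y hy
  obtain ⟨M, hM⟩ := hcs.exists_bound_of_continuous hcd.continuous
  obtain ⟨L, hL⟩ := hcd.lipschitzWith_of_hasCompactSupport hcs one_ne_zero
  refine ⟨_, M.toNNReal, L, ρ, hρ, hρD, fun x hx => ?_, fun x => (hM x).trans (le_max_left _ _), hL⟩
  simp [hχ1.self_of_nhdsSet x hx]

/-! ### Trajectories of a family of vector fields depending linearly on a parameter -/

/-- `y` solves `y' = -V(y) ε` on `[0, 1]` with `y 0 = x`. -/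
structure IsTrajectory {E : Type*} [NormedAddCommGroup E] [NormedSpace ℝ E]
    (V : E → E →L[ℝ] E) (ε x : E) (y : ℝ → E) : Prop where
  init : y 0 = x
  deriv : ∀ t ∈ Set.Icc (0 : ℝ) 1, HasDerivWithinAt y (-(V (y t) ε)) (Set.Icc 0 1) t

section Trajectory

variable {E : Type*} [NormedAddCommGroup E] [NormedSpace ℝ E] {V : E → E →L[ℝ] E} {M L : NNReal}
  {ε ε' x x' : E} {y y' : ℝ → E}

theorem lipschitzWith_neg_apply (hL : LipschitzWith L V) (ε : E) :
    LipschitzWith (L * ‖ε‖₊) fun z => -(V z ε) := by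
  refine LipschitzWith.of_dist_le_mul fun a b => ?_
  rw [dist_neg_neg, dist_eq_norm, ← sub_apply]
  calc ‖(V a - V b) ε‖ ≤ ‖V a - V b‖ * ‖ε‖ := (V a - V b).le_opNorm ε
    _ ≤ (L * dist a b) * ‖ε‖ := by gcongr; rw [← dist_eq_norm]; exact hL.dist_le_mul a b
    _ = _ := by push_cast; ring

theorem exists_isTrajectory [CompleteSpace E] (hM : ∀ x, ‖V x‖ ≤ M) (hL : LipschitzWith L V)
    (ε x : E) : ∃ y, IsTrajectory V ε x y := by
  have h : IsPicardLindelof (fun _ z => -(V z ε)) (⟨0, by simp⟩ : Set.Icc (0 : ℝ) 1) x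
      (M * ‖ε‖₊) 0 (M * ‖ε‖₊) (L * ‖ε‖₊) := by
    refine .of_time_independent (fun z _ => ?_) (lipschitzWith_neg_apply hL ε).lipschitzOnWith ?_
    · rw [norm_neg]
      exact (V z).le_of_opNorm_le (hM z) ε
    · simp
  obtain ⟨y, h0, hy⟩ := h.exists_eq_forall_mem_Icc_hasDerivWithinAt₀
  exact ⟨y, h0, hy⟩

namespace IsTrajectory

theorem continuousOn (h : IsTrajectory V ε x y) : ContinuousOn y (Set.Icc 0 1) :=
  fun t ht => (h.deriv t ht).continuousWithinAt

theorem hasDerivWithinAt_Ici (h : IsTrajectory V ε x y) {t : ℝ} (ht : t ∈ Set.Ico (0 : ℝ) 1) :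
    HasDerivWithinAt y (-(V (y t) ε)) (Set.Ici t) t :=
  (h.deriv t (Set.Ico_subset_Icc_self ht)).mono_of_mem_nhdsWithin
    (Icc_mem_nhdsGE_of_mem ht)

theorem norm_sub_init_le (hM : ∀ x, ‖V x‖ ≤ M) (h : IsTrajectory V ε x y) {t : ℝ}
    (ht : t ∈ Set.Icc (0 : ℝ) 1) : ‖y t - x‖ ≤ M * ‖ε‖ := by
  have := norm_image_sub_le_of_norm_deriv_le_segment' h.deriv (C := M * ‖ε‖)
    (fun s _ => by rw [norm_neg]; exact (V (y s)).le_of_opNorm_le (hM _) ε) t ht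
  rw [h.init, sub_zero] at this
  exact this.trans (mul_le_of_le_one_right (by positivity) ht.2)

theorem dist_le_of_init (hL : LipschitzWith L V) (h : IsTrajectory V ε x y)
    (h' : IsTrajectory V ε x' y') : dist (y 1) (y' 1) ≤ dist x x' * Real.exp (L * ‖ε‖) := by
  have := dist_le_of_trajectories_ODE (v := fun _ z => -(V z ε)) (δ := dist x x')
    (fun _ => lipschitzWith_neg_apply hL ε) h.continuousOn
    (fun t ht => h.hasDerivWithinAt_Ici ht) h'.continuousOn
    (fun t ht => h'.hasDerivWithinAt_Ici ht) (by rw [h.init, h'.init]) 1 (by simp)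
  simpa using this

theorem norm_sub_le_of_param (hM : ∀ x, ‖V x‖ ≤ M) (hL : LipschitzWith L V)
    (h : IsTrajectory V ε x y) (h' : IsTrajectory V ε' x y') (hε : ‖ε‖ ≤ 1) {t : ℝ}
    (ht : t ∈ Set.Icc (0 : ℝ) 1) :
    ‖y t - y' t‖ ≤ M * Real.exp (L + 1) * ‖ε - ε'‖ := by
  -- The constant `L + 1` in place of `L * ‖ε‖` is uniform in `ε` and nonzero, as the closed form of
  -- the Grönwall bound requires.
  have hLip : LipschitzWith (L + 1) fun z => -(V z ε) :=
    (lipschitzWith_neg_apply hL ε).weaken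
      ((mul_le_of_le_one_right zero_le (show ‖ε‖₊ ≤ 1 from hε)).trans (by simp))
  have hg : ∀ s ∈ Set.Ico (0 : ℝ) 1,
      dist (-(V (y' s) ε')) (-(V (y' s) ε)) ≤ M * ‖ε - ε'‖ := by
    intro s _
    rw [dist_neg_neg, dist_comm, dist_eq_norm, ← map_sub]
    exact (V (y' s)).le_of_opNorm_le (hM _) _
  have := dist_le_of_approx_trajectories_ODE (v := fun _ z => -(V z ε)) (δ := 0)
    (fun _ => hLip) h.continuousOn
    (fun t ht => h.hasDerivWithinAt_Ici ht) (fun s _ => (dist_self _).le) h'.continuousOn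
    (fun t ht => h'.hasDerivWithinAt_Ici ht) hg (by rw [h.init, h'.init, dist_self]) t ht
  rw [← dist_eq_norm]
  refine this.trans ?_
  have hL1 : (0 : ℝ) < (L + 1 : NNReal) := by positivity
  rw [gronwallBound_of_K_ne_0 hL1.ne']
  have h1 : Real.exp ((L + 1 : NNReal) * (t - 0)) - 1 ≤ Real.exp (L + 1) := by
    have : Real.exp ((L + 1 : NNReal) * (t - 0)) ≤ Real.exp (L + 1) := by
      apply Real.exp_le_exp.2
      push_cast
      nlinarith [ht.2, L.coe_nonneg]
    linarith
  have h0 : 0 ≤ Real.exp ((L + 1 : NNReal) * (t - 0)) - 1 := by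
    have := Real.add_one_le_exp ((L + 1 : NNReal) * (t - 0) : ℝ)
    have h2 : 0 ≤ ((L + 1 : NNReal) * (t - 0) : ℝ) := mul_nonneg hL1.le (by linarith [ht.1])
    linarith
  have h3 : (0 + M * ‖ε - ε'‖) / ((L + 1 : NNReal) : ℝ) ≤ M * ‖ε - ε'‖ := by
    rw [zero_add]
    exact div_le_self (by positivity) (by push_cast; linarith [L.coe_nonneg])
  calc _ = (0 + M * ‖ε - ε'‖) / ((L + 1 : NNReal) : ℝ) *
        (Real.exp ((L + 1 : NNReal) * (t - 0)) - 1) := by ring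
    _ ≤ (M * ‖ε - ε'‖) * Real.exp (L + 1) := by gcongr
    _ = _ := by ring

/-- First-order expansion of the endpoint in the parameter, in a form that also controls the
Lipschitz constant of the remainder. -/
theorem norm_sub_add_le (hM : ∀ x, ‖V x‖ ≤ M) (hL : LipschitzWith L V)
    (h : IsTrajectory V ε x y) (h' : IsTrajectory V ε' x y') (hε : ‖ε‖ ≤ 1) :
    ‖y 1 - y' 1 + V x (ε - ε')‖ ≤
      L * M * Real.exp (L + 1) * (‖ε‖ + ‖ε'‖) * ‖ε - ε'‖ := by
  have hd : ∀ t ∈ Set.Icc (0 : ℝ) 1,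
      HasDerivWithinAt (fun t => y t - y' t + t • V x (ε - ε'))
        (-(V (y t) ε) - -(V (y' t) ε') + V x (ε - ε')) (Set.Icc 0 1) t := by
    intro t ht
    have h1 := ((h.deriv t ht).sub (h'.deriv t ht)).add
      ((hasDerivWithinAt_id t (Set.Icc 0 1)).smul_const (V x (ε - ε')))
    rw [one_smul] at h1
    exact h1
  have hb : ∀ t ∈ Set.Ico (0 : ℝ) 1, ‖-(V (y t) ε) - -(V (y' t) ε') + V x (ε - ε')‖ ≤
      L * M * Real.exp (L + 1) * (‖ε‖ + ‖ε'‖) * ‖ε - ε'‖ := by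
    intro t ht
    have ht' := Set.Ico_subset_Icc_self ht
    have e : -(V (y t) ε) - -(V (y' t) ε') + V x (ε - ε') =
        -((V (y t) - V x) (ε - ε') + (V (y t) - V (y' t)) ε') := by
      simp only [sub_apply, map_sub]; abel
    have h1 : ‖(V (y t) - V x) (ε - ε')‖ ≤ L * (M * ‖ε‖) * ‖ε - ε'‖ := by
      refine (V (y t) - V x).le_of_opNorm_le ?_ _
      refine (hL.norm_sub_le _ _).trans ?_
      gcongr
      exact h.norm_sub_init_le hM ht'
    have h2 : ‖(V (y t) - V (y' t)) ε'‖ ≤ L * (M * Real.exp (L + 1) * ‖ε - ε'‖) * ‖ε'‖ := by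
      refine (V (y t) - V (y' t)).le_of_opNorm_le ?_ _
      refine (hL.norm_sub_le _ _).trans ?_
      gcongr
      exact h.norm_sub_le_of_param hM hL h' hε ht'
    have h3 : L * (M * ‖ε‖) * ‖ε - ε'‖ ≤ L * (M * ‖ε‖) * ‖ε - ε'‖ * Real.exp (L + 1) :=
      le_mul_of_one_le_right (by positivity) (Real.one_le_exp (by positivity))
    rw [e, norm_neg]
    calc _ ≤ _ := norm_add_le _ _
      _ ≤ L * (M * ‖ε‖) * ‖ε - ε'‖ * Real.exp (L + 1) +
          L * (M * Real.exp (L + 1) * ‖ε - ε'‖) * ‖ε'‖ := add_le_add (h1.trans h3) h2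
      _ = _ := by ring
  have := norm_image_sub_le_of_norm_deriv_le_segment' hd hb 1 (by simp)
  simpa [h.init, h'.init] using this

end IsTrajectory

end Trajectory

/-! ### A quantitative inverse function lemma -/

/-- If `f` is close to the affine map `ε ↦ f 0 - A ε` near the origin, with an error that is
quadratically small together with its increments, then `f` has a unique zero near the origin, and
that zero is `A⁻¹ (f 0)` up to a quadratic error. -/
theorem existsUnique_zero_of_quadratic_remainder {E : Type*} [NormedAddCommGroup E]
    [NormedSpace ℝ E] [CompleteSpace E] {A B : E →L[ℝ] E} (hBA : ∀ v, B (A v) = v)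
    (hAB : ∀ v, A (B v) = v) (hB : ‖B‖ ≤ 2) {f : E → E} {C r : ℝ} (hC : 0 ≤ C) (hr : 0 < r)
    (hCr : 8 * C * r ≤ 1) (hf0 : 8 * ‖f 0‖ ≤ r)
    (hf : ∀ ε ε', ‖ε‖ ≤ r → ‖ε'‖ ≤ r →
      ‖f ε - f ε' + A (ε - ε')‖ ≤ C * (‖ε‖ + ‖ε'‖) * ‖ε - ε'‖) :
    (∃! ε, ‖ε‖ < r ∧ f ε = 0) ∧
      ∀ ε, ‖ε‖ < r → f ε = 0 →
        ‖ε‖ ≤ 2 * ‖B (f 0)‖ ∧ ‖ε - B (f 0)‖ ≤ 8 * C * ‖B (f 0)‖ ^ 2 := by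
  -- The simplified Newton map, whose fixed points are the zeros of `f`.
  set T : E → E := fun ε => ε + B (f ε) with hT
  have hTq : ∀ ε ε', ‖ε‖ ≤ r → ‖ε'‖ ≤ r →
      ‖T ε - T ε'‖ ≤ 2 * (C * (‖ε‖ + ‖ε'‖) * ‖ε - ε'‖) := by
    intro ε ε' h h'
    have e : T ε - T ε' = B (f ε - f ε' + A (ε - ε')) := by
      simp only [hT, map_add, map_sub, hBA]; abel
    rw [e]
    exact (B.le_of_opNorm_le hB _).trans (by gcongr; exact hf ε ε' h h')
  have hTl : ∀ ε ε', ‖ε‖ ≤ r → ‖ε'‖ ≤ r → ‖T ε - T ε'‖ ≤ 1 / 2 * ‖ε - ε'‖ := by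
    intro ε ε' h h'
    refine (hTq ε ε' h h').trans ?_
    have : 2 * (C * (‖ε‖ + ‖ε'‖)) ≤ 1 / 2 := by nlinarith
    calc _ = 2 * (C * (‖ε‖ + ‖ε'‖)) * ‖ε - ε'‖ := by ring
      _ ≤ _ := by gcongr
  have hfix : ∀ ε, f ε = 0 ↔ T ε = ε := by
    intro ε
    simp only [hT, add_eq_left]
    constructor
    · intro h; rw [h, map_zero]
    · intro h; rw [← hAB (f ε), h, map_zero]
  have hT0 : T 0 = B (f 0) := by simp [hT]
  have hT0r : ‖T 0‖ ≤ r / 4 := by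
    rw [hT0]; exact (B.le_of_opNorm_le hB _).trans (by linarith)
  have hmaps : Set.MapsTo T (Metric.closedBall 0 (r / 2)) (Metric.closedBall 0 (r / 2)) := by
    intro ε hε
    rw [mem_closedBall_zero_iff] at hε ⊢
    have h1 := hTl ε 0 (by linarith) (by simpa using hr.le)
    rw [sub_zero] at h1
    have h2 : ‖T ε‖ ≤ ‖T ε - T 0‖ + ‖T 0‖ := norm_le_norm_sub_add _ _
    linarith
  have hcontr : ContractingWith (1 / 2) (hmaps.restrict T _ _) := by
    refine ⟨by rw [div_lt_one] <;> norm_num, LipschitzWith.of_dist_le_mul fun a b => ?_⟩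
    have ha := a.2
    have hb := b.2
    rw [mem_closedBall_zero_iff] at ha hb
    rw [Subtype.dist_eq, Subtype.dist_eq, dist_eq_norm, dist_eq_norm]
    simpa using hTl a b (by linarith) (by linarith)
  obtain ⟨ε₀, hε₀, hfx, -⟩ := hcontr.exists_fixedPoint' Metric.isClosed_closedBall.isComplete hmaps
    (x := 0) (by simpa using by linarith) (edist_ne_top _ _)
  rw [mem_closedBall_zero_iff] at hε₀
  refine ⟨⟨ε₀, ⟨by linarith, (hfix ε₀).2 hfx⟩, ?_⟩, ?_⟩
  · rintro ε ⟨hε, h0⟩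
    have h1 := hTl ε ε₀ hε.le (by linarith)
    rw [(hfix ε).1 h0, hfx.eq] at h1
    have : ‖ε - ε₀‖ = 0 := le_antisymm (by linarith) (norm_nonneg _)
    exact sub_eq_zero.1 (norm_eq_zero.1 this)
  · intro ε hε h0
    have h1 := hTl ε 0 hε.le (by simpa using hr.le)
    have h2 := hTq ε 0 hε.le (by simpa using hr.le)
    rw [(hfix ε).1 h0, hT0] at h1 h2
    rw [sub_zero] at h1
    simp only [norm_zero, add_zero, sub_zero] at h2
    have h3 : ‖ε‖ ≤ 2 * ‖B (f 0)‖ := by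
      have : ‖ε‖ ≤ ‖ε - B (f 0)‖ + ‖B (f 0)‖ := norm_le_norm_sub_add _ _
      linarith
    refine ⟨h3, h2.trans ?_⟩
    calc 2 * (C * ‖ε‖ * ‖ε‖) ≤ 2 * (C * (2 * ‖B (f 0)‖) * (2 * ‖B (f 0)‖)) := by gcongr
      _ = _ := by ring

/-! ### The logarithm of a perturbed group element -/

theorem Matrix.toEuclideanLin_eq_toEuclideanCLM {N : ℕ} (A : Matrix (Fin N) (Fin N) ℝ)
    (v : EuclideanSpace ℝ (Fin N)) :
    Matrix.toEuclideanLin A v = Matrix.toEuclideanCLM (𝕜 := ℝ) A v := rfl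

theorem Matrix.toEuclideanCLM_mul_apply {N : ℕ} (A B : Matrix (Fin N) (Fin N) ℝ)
    (v : EuclideanSpace ℝ (Fin N)) :
    Matrix.toEuclideanCLM (𝕜 := ℝ) A (Matrix.toEuclideanCLM (𝕜 := ℝ) B v) =
      Matrix.toEuclideanCLM (𝕜 := ℝ) (A * B) v := by
  rw [map_mul]; rfl

namespace MatrixLieGroup

variable {n N : ℕ} (G : MatrixLieGroup n N)

/-- Along a trajectory of `y' = -J_l(y)⁻¹ ε`, the product `exp(t ε) exp(y t)` is constant. -/
theorem Exp_trajectory_eq {V : EuclideanSpace ℝ (Fin N) →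
      EuclideanSpace ℝ (Fin N) →L[ℝ] EuclideanSpace ℝ (Fin N)}
    {ε x : EuclideanSpace ℝ (Fin N)} {y : ℝ → EuclideanSpace ℝ (Fin N)}
    (h : IsTrajectory V ε x y)
    (hV : ∀ t ∈ Set.Icc (0 : ℝ) 1, Matrix.toEuclideanLin (G.leftJac (y t)) (V (y t) ε) = ε) :
    G.Exp (y 1) = (G.Exp ε)⁻¹ * G.Exp x := by
  set c : ℝ → Matrix (Fin n) (Fin n) ℝ := fun t =>
    NormedSpace.exp (t • G.wedge ε) * NormedSpace.exp (G.wedge (y t)) with hc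
  have hd : ∀ t ∈ Set.Icc (0 : ℝ) 1, HasDerivWithinAt c 0 (Set.Icc 0 1) t := by
    intro t ht
    have h1 : HasDerivWithinAt (fun t => NormedSpace.exp (G.wedge (y t)))
        (fderiv ℝ (fun p => NormedSpace.exp (G.wedge p)) (y t) (-(V (y t) ε)))
        (Set.Icc 0 1) t :=
      (((G.contDiff_exp_wedge (k := 1)).differentiable one_ne_zero
        (y t)).hasFDerivAt).comp_hasDerivWithinAt t (h.deriv t ht)
    have h2 := (hasDerivAt_exp_smul_const (𝕂 := ℝ) (G.wedge ε) t).hasDerivWithinAt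
      (s := Set.Icc 0 1)
    refine (h2.mul h1).congr_deriv ?_
    have hw : G.wedge (-ε) = -G.wedge ε := G.wedgeCLM.map_neg ε
    rw [fderiv_exp_wedge_eq, map_neg, hV t ht, hw]
    noncomm_ring
  have hconst : c 1 = c 0 :=
    constant_of_has_deriv_right_zero (fun t ht => (hd t ht).continuousWithinAt)
      (fun t ht => (hd t (Set.Ico_subset_Icc_self ht)).mono_of_mem_nhdsWithin
        (Icc_mem_nhdsGE_of_mem ht)) 1 (by simp)
  rw [eq_inv_mul_iff_mul_eq]
  apply Subtype.ext
  ext1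
  have hconst' : NormedSpace.exp (G.wedge ε) * NormedSpace.exp (G.wedge (y 1)) =
      NormedSpace.exp (G.wedge x) := by simpa [hc, h.init] using hconst
  exact hconst'

theorem log_Exp {D : Set (EuclideanSpace ℝ (Fin N))} (hD : G.IsExpDomain D)
    {q : EuclideanSpace ℝ (Fin N)} (hq : q ∈ D) : G.log D (G.Exp q) = q :=
  hD.injOn.leftInvOn_invFunOn hq

end MatrixLieGroup

/-- The estimates on the logarithm that the mean equation uses: `φ ε x` stands for the logarithm of
`exp(ε)⁻¹ exp(x)` and `R` for `J_l⁻¹`, both extended from a compact set to the whole space so that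
the bounds hold globally. -/
structure IsLogExpansion {N : ℕ}
    (R : EuclideanSpace ℝ (Fin N) → Matrix (Fin N) (Fin N) ℝ)
    (φ : EuclideanSpace ℝ (Fin N) → EuclideanSpace ℝ (Fin N) → EuclideanSpace ℝ (Fin N))
    (M L : NNReal) (C : ℝ) : Prop where
  norm_le : ∀ x, ‖R x‖ ≤ M
  lipschitz : LipschitzWith L R
  zero : R 0 = 1
  continuous : ∀ ε, Continuous (φ ε)
  norm_sub_le : ∀ ε x, ‖φ ε x - x‖ ≤ M * ‖ε‖
  expansion : ∀ ε ε' x, ‖ε‖ ≤ 1 →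
    ‖φ ε x - φ ε' x + Matrix.toEuclideanCLM (𝕜 := ℝ) (R x) (ε - ε')‖ ≤
      C * (‖ε‖ + ‖ε'‖) * ‖ε - ε'‖

/-- Near a compact subset of an exponential domain, `exp(ε)⁻¹ exp(x)` has a logarithm in the domain
given by the endpoint of the trajectory of `y' = -J_l(y)⁻¹ ε` that starts at `x`. -/
theorem MatrixLieGroup.exists_isLogExpansion {n N : ℕ} (G : MatrixLieGroup n N)
    {D K : Set (EuclideanSpace ℝ (Fin N))} (hD : G.IsExpDomain D) (hK : IsCompact K)
    (hKD : K ⊆ D) :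
    ∃ R φ M L C ρ, 0 ≤ C ∧ 0 < ρ ∧ IsLogExpansion R φ M L C ∧
      (∀ x ∈ K, R x = (G.leftJac x)⁻¹) ∧
      ∀ ε x, ‖ε‖ ≤ ρ → x ∈ K →
        φ ε x ∈ D ∧ G.Exp (φ ε x) = (G.Exp ε)⁻¹ * G.Exp x := by
  -- The origin is adjoined to the compact set so that the normalization `J_l(0) = 1` survives
  -- the cutoff.
  obtain ⟨R, M, L, ρ, hρ, hρD, hRJ, hM, hL⟩ := exists_bounded_lipschitz_eqOn_cthickening
    (hK.insert 0) hD.isOpen (Set.insert_subset hD.zero_mem hKD)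
    (fun q hq => G.contDiffAt_leftJac_inv (hD.isUnit_leftJac q hq))
  have hself := Metric.self_subset_cthickening (δ := ρ) (insert 0 K)
  set V : EuclideanSpace ℝ (Fin N) → EuclideanSpace ℝ (Fin N) →L[ℝ] EuclideanSpace ℝ (Fin N) :=
    fun q => Matrix.toEuclideanCLM (𝕜 := ℝ) (R q) with hV
  have hVM : ∀ q, ‖V q‖ ≤ M := hM
  have hVL : LipschitzWith L V := by
    refine LipschitzWith.of_dist_le_mul fun a b => ?_
    rw [dist_eq_norm, hV, ← map_sub, Matrix.l2_opNorm_toEuclideanCLM, ← dist_eq_norm]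
    exact hL.dist_le_mul a b
  choose Y hY using fun ε x => exists_isTrajectory hVM hVL ε x
  refine ⟨R, fun ε x => Y ε x 1, M, L, L * M * Real.exp (L + 1), ρ / (M + 1), by positivity,
    by positivity, ⟨hM, hL, ?_, fun ε => ?_, fun ε x => ?_, fun ε ε' x hε => ?_⟩,
    fun x hx => hRJ (hself (Set.mem_insert_of_mem _ hx)), fun ε x hε hx => ?_⟩
  · rw [hRJ (hself (Set.mem_insert _ _))]
    simp [G.leftJac_zero]
  · refine (LipschitzWith.of_dist_le_mul (K := ⟨Real.exp (L * ‖ε‖), (Real.exp_pos _).le⟩)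
      fun a b => ?_).continuous
    rw [mul_comm]
    exact (hY ε a).dist_le_of_init hVL (hY ε b)
  · exact (hY ε x).norm_sub_init_le hVM (by simp)
  · exact (hY ε x).norm_sub_add_le hVM hVL (hY ε' x) hε
  · have hMε : M * ‖ε‖ ≤ ρ := by
      rw [le_div_iff₀ (by positivity)] at hε
      nlinarith [norm_nonneg ε]
    have hmem : ∀ t ∈ Set.Icc (0 : ℝ) 1, Y ε x t ∈ Metric.cthickening ρ (insert 0 K) := by
      intro t ht
      refine Metric.mem_cthickening_of_dist_le _ x _ _ (Set.mem_insert_of_mem _ hx) ?_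
      rw [dist_eq_norm]
      exact ((hY ε x).norm_sub_init_le hVM ht).trans hMε
    refine ⟨hρD (hmem 1 (by simp)), G.Exp_trajectory_eq (hY ε x) fun t ht => ?_⟩
    have hu := (Matrix.isUnit_iff_isUnit_det _).1 (hD.isUnit_leftJac _ (hρD (hmem t ht)))
    rw [Matrix.toEuclideanLin_eq_toEuclideanCLM, hV]
    dsimp only
    rw [Matrix.toEuclideanCLM_mul_apply, hRJ (hmem t ht), Matrix.mul_nonsing_inv _ hu, map_one]
    rfl

/-! ### Outer products and second moments -/

section Moments

variable {N : ℕ}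

theorem norm_outer_le (a b : EuclideanSpace ℝ (Fin N)) : ‖outer a b‖ ≤ ‖a‖ * ‖b‖ := by
  rw [← Matrix.l2_opNorm_toEuclideanCLM]
  refine ContinuousLinearMap.opNorm_le_bound _ (by positivity) fun v => ?_
  have h : Matrix.toEuclideanCLM (𝕜 := ℝ) (outer a b) v = inner ℝ b v • a := by
    ext i
    simp [Matrix.mulVec, dotProduct, outer, PiLp.inner_apply, Finset.mul_sum, mul_comm]
    exact Finset.sum_congr rfl fun _ _ => by ring
  rw [h, norm_smul]
  calc _ ≤ (‖b‖ * ‖v‖) * ‖a‖ := by gcongr; exact norm_inner_le_norm b v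
    _ = _ := by ring

/-- The outer product as a continuous bilinear map. -/
def outerCLM : EuclideanSpace ℝ (Fin N) →L[ℝ] EuclideanSpace ℝ (Fin N) →L[ℝ]
    Matrix (Fin N) (Fin N) ℝ :=
  LinearMap.mkContinuous₂
    (LinearMap.mk₂ ℝ outer
      (fun _ _ _ => by ext; simp [outer, add_mul])
      (fun _ _ _ => by ext; simp [outer, mul_assoc])
      (fun _ _ _ => by ext; simp [outer, mul_add])
      (fun _ _ _ => by ext; simp [outer, mul_left_comm])) 1
    (fun a b => by simpa using norm_outer_le a b)

theorem outerCLM_apply (a b : EuclideanSpace ℝ (Fin N)) : outerCLM a b = outer a b := rfl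

/-- Evaluation of a matrix at a vector, as a continuous linear map in the matrix. -/
def evalCLM (v : EuclideanSpace ℝ (Fin N)) :
    Matrix (Fin N) (Fin N) ℝ →L[ℝ] EuclideanSpace ℝ (Fin N) :=
  LinearMap.toContinuousLinearMap
    ((LinearMap.applyₗ v).comp (Matrix.toEuclideanLin (𝕜 := ℝ) (m := Fin N) (n := Fin N)).toLinearMap)

theorem evalCLM_apply (v : EuclideanSpace ℝ (Fin N)) (A : Matrix (Fin N) (Fin N) ℝ) :
    evalCLM v A = Matrix.toEuclideanCLM (𝕜 := ℝ) A v := rfl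

/-- The transpose as a continuous linear map. -/
def transposeCLM : Matrix (Fin N) (Fin N) ℝ →L[ℝ] Matrix (Fin N) (Fin N) ℝ :=
  LinearMap.toContinuousLinearMap (Matrix.transposeLinearEquiv (Fin N) (Fin N) ℝ ℝ).toLinearMap

theorem transposeCLM_apply (A : Matrix (Fin N) (Fin N) ℝ) : transposeCLM A = Aᵀ := rfl

/-- The trace as a continuous linear functional. -/
def traceCLM (N : ℕ) : Matrix (Fin N) (Fin N) ℝ →L[ℝ] ℝ :=
  LinearMap.toContinuousLinearMap (Matrix.traceLinearMap (Fin N) ℝ ℝ)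

theorem traceCLM_outer_self (a : EuclideanSpace ℝ (Fin N)) :
    traceCLM N (outer a a) = ‖a‖ ^ 2 := by
  rw [EuclideanSpace.norm_sq_eq]
  simp [traceCLM, Matrix.trace, outer, sq]

theorem integrable_comp_of_ae_mem_isCompact {E F Ω : Type*} [NormedAddCommGroup E]
    [MeasurableSpace E] [BorelSpace E] [SecondCountableTopology E] [NormedAddCommGroup F]
    [MeasurableSpace Ω] {P : Measure Ω} [IsFiniteMeasure P] {K : Set E} (hK : IsCompact K)
    {x : Ω → E} (hx : AEMeasurable x P) (hxK : ∀ᵐ ω ∂P, x ω ∈ K) {f : E → F}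
    (hf : Continuous f) : Integrable (fun ω => f (x ω)) P := by
  obtain ⟨B, hB⟩ := hK.exists_bound_of_continuousOn hf.continuousOn
  refine Integrable.of_bound (hf.comp_aestronglyMeasurable hx.aestronglyMeasurable) B ?_
  filter_upwards [hxK] with ω hω using hB _ hω

variable {Ω : Type*} [MeasurableSpace Ω] {P : Measure Ω} [IsProbabilityMeasure P]
  {K : Set (EuclideanSpace ℝ (Fin N))} {x : Ω → EuclideanSpace ℝ (Fin N)}

theorem integral_outer_self (hK : IsCompact K) (hx : AEMeasurable x P)
    (hxK : ∀ᵐ ω ∂P, x ω ∈ K) :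
    ∫ ω, outer (x ω) (x ω) ∂P = covMatrix P x + outer (meanVec P x) (meanVec P x) := by
  set m := meanVec P x with hm
  have h0 : Integrable x P := integrable_comp_of_ae_mem_isCompact hK hx hxK continuous_id
  have h1 : Integrable (fun ω => outerCLM (x ω) (x ω)) P :=
    integrable_comp_of_ae_mem_isCompact hK hx hxK (f := fun z => outerCLM z z) (by fun_prop)
  have h2 : Integrable (fun ω => outerCLM.flip m (x ω)) P := ContinuousLinearMap.integrable_comp _ h0
  have h3 : Integrable (fun ω => outerCLM m (x ω)) P := ContinuousLinearMap.integrable_comp _ h0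
  have e : covMatrix P x = ∫ ω, (outerCLM (x ω) (x ω) - outerCLM.flip m (x ω) - outerCLM m (x ω) +
      outerCLM m m) ∂P := by
    refine integral_congr_ae (.of_forall fun ω => ?_)
    simp only [← outerCLM_apply, ← hm, map_sub, sub_apply, ContinuousLinearMap.flip_apply]
    abel
  have h12 : Integrable (fun ω => outerCLM (x ω) (x ω) - outerCLM.flip m (x ω)) P := h1.sub h2
  have h123 : Integrable
      (fun ω => outerCLM (x ω) (x ω) - outerCLM.flip m (x ω) - outerCLM m (x ω)) P := h12.sub h3
  rw [e, integral_add h123 (integrable_const _), integral_sub h12 h3, integral_sub h1 h2,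
    ContinuousLinearMap.integral_comp_comm _ h0,
    ContinuousLinearMap.integral_comp_comm _ h0]
  have hm' : ∫ ω, x ω ∂P = m := rfl
  simp [hm', outerCLM_apply]

/-- The left-hand side is the trace of the covariance matrix. -/
theorem integral_norm_sub_mean_sq_le (hK : IsCompact K) (hx : AEMeasurable x P)
    (hxK : ∀ᵐ ω ∂P, x ω ∈ K) :
    ∫ ω, ‖x ω - meanVec P x‖ ^ 2 ∂P ≤ ‖traceCLM N‖ * ‖covMatrix P x‖ := by
  have h1 : Integrable (fun ω => outerCLM (x ω - meanVec P x) (x ω - meanVec P x)) P :=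
    integrable_comp_of_ae_mem_isCompact hK hx hxK
      (f := fun z => outerCLM (z - meanVec P x) (z - meanVec P x)) (by fun_prop)
  have e : ∫ ω, ‖x ω - meanVec P x‖ ^ 2 ∂P = traceCLM N (covMatrix P x) := by
    rw [covMatrix]
    simp only [← outerCLM_apply]
    rw [← ContinuousLinearMap.integral_comp_comm _ h1]
    simp only [outerCLM_apply, traceCLM_outer_self]
  rw [e]
  exact (le_abs_self _).trans ((traceCLM N).le_opNorm _)

/-- A random vector with small mean and small covariance is small in mean. -/
theorem integral_norm_le (hK : IsCompact K) (hx : AEMeasurable x P)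
    (hxK : ∀ᵐ ω ∂P, x ω ∈ K) {η : ℝ} (hη : 0 < η) :
    ∫ ω, ‖x ω‖ ∂P ≤ ‖meanVec P x‖ + η + ‖traceCLM N‖ * ‖covMatrix P x‖ / η := by
  have hsq : Integrable (fun ω => ‖x ω - meanVec P x‖ ^ 2) P :=
    integrable_comp_of_ae_mem_isCompact hK hx hxK
      (f := fun z => ‖z - meanVec P x‖ ^ 2) (by fun_prop)
  have hn : Integrable (fun ω => ‖x ω‖) P :=
    integrable_comp_of_ae_mem_isCompact hK hx hxK (f := fun z => ‖z‖) (by fun_prop)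
  calc ∫ ω, ‖x ω‖ ∂P ≤ ∫ ω, ((‖meanVec P x‖ + η) + ‖x ω - meanVec P x‖ ^ 2 / η) ∂P := by
        refine integral_mono hn ((integrable_const _).add (hsq.div_const η)) fun ω => ?_
        have h1 : ‖x ω‖ ≤ ‖x ω - meanVec P x‖ + ‖meanVec P x‖ := norm_le_norm_sub_add _ _
        have h2 : ‖x ω - meanVec P x‖ ≤ η + ‖x ω - meanVec P x‖ ^ 2 / η := by
          rw [← sub_le_iff_le_add', le_div_iff₀ hη]
          nlinarith [sq_nonneg (‖x ω - meanVec P x‖ - η), norm_nonneg (x ω - meanVec P x)]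
        dsimp only
        linarith
    _ = (‖meanVec P x‖ + η) + (∫ ω, ‖x ω - meanVec P x‖ ^ 2 ∂P) / η := by
        rw [integral_add (integrable_const _) (hsq.div_const η), integral_div]
        simp
    _ ≤ _ := by gcongr; exact integral_norm_sub_mean_sq_le hK hx hxK

end Moments

/-! ### The mean equation and the covariance -/

namespace IsLogExpansion

variable {N : ℕ} {R : EuclideanSpace ℝ (Fin N) → Matrix (Fin N) (Fin N) ℝ}
  {φ : EuclideanSpace ℝ (Fin N) → EuclideanSpace ℝ (Fin N) → EuclideanSpace ℝ (Fin N)}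
  {M L : NNReal} {C : ℝ}

theorem apply_zero (h : IsLogExpansion R φ M L C) (x : EuclideanSpace ℝ (Fin N)) : φ 0 x = x := by
  have := h.norm_sub_le 0 x
  rw [norm_zero, mul_zero] at this
  exact sub_eq_zero.1 (norm_le_zero_iff.1 this)

/-- Pointwise expansion of the second moment. -/
theorem norm_outer_sub_le (h : IsLogExpansion R φ M L C) (hC : 0 ≤ C) {B c : ℝ}
    {ε m' x : EuclideanSpace ℝ (Fin N)} (hx : ‖x‖ ≤ B) (hε : ‖ε‖ ≤ 1) (hεm : ‖ε‖ ≤ 2 * ‖m'‖)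
    (hm : ‖ε - m'‖ ≤ c * ‖m'‖ ^ 2) :
    ‖outer (φ ε x) (φ ε x) - (outer x x -
        (outer (Matrix.toEuclideanCLM (𝕜 := ℝ) (R x) m') x +
          outer x (Matrix.toEuclideanCLM (𝕜 := ℝ) (R x) m')))‖ ≤
      (2 * B * (4 * C + M * c) + 4 * M ^ 2) * ‖m'‖ ^ 2 := by
  set w := Matrix.toEuclideanCLM (𝕜 := ℝ) (R x) m' with hw
  set d := φ ε x - x with hd
  have hd1 : ‖d‖ ≤ 2 * M * ‖m'‖ := by
    refine (h.norm_sub_le ε x).trans ?_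
    calc M * ‖ε‖ ≤ M * (2 * ‖m'‖) := by gcongr
      _ = _ := by ring
  have hdw : ‖d + w‖ ≤ (4 * C + M * c) * ‖m'‖ ^ 2 := by
    have h1 := h.expansion ε 0 x hε
    simp only [h.apply_zero, norm_zero, add_zero, sub_zero] at h1
    have h2 : ‖Matrix.toEuclideanCLM (𝕜 := ℝ) (R x) (ε - m')‖ ≤ M * (c * ‖m'‖ ^ 2) :=
      ((Matrix.toEuclideanCLM (𝕜 := ℝ) (R x)).le_of_opNorm_le (h.norm_le x) _).trans (by gcongr)
    have e : d + w = (φ ε x - x + Matrix.toEuclideanCLM (𝕜 := ℝ) (R x) ε) -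
        Matrix.toEuclideanCLM (𝕜 := ℝ) (R x) (ε - m') := by
      rw [hd, hw, map_sub]; abel
    rw [e]
    calc _ ≤ _ := _root_.norm_sub_le _ _
      _ ≤ C * ‖ε‖ * ‖ε‖ + M * (c * ‖m'‖ ^ 2) := add_le_add h1 h2
      _ ≤ C * (2 * ‖m'‖) * (2 * ‖m'‖) + M * (c * ‖m'‖ ^ 2) := by gcongr
      _ = _ := by ring
  have e : outer (φ ε x) (φ ε x) - (outer x x - (outer w x + outer x w)) =
      outer x (d + w) + outer (d + w) x + outer d d := by
    have hφ : φ ε x = x + d := by rw [hd]; abel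
    rw [hφ]
    simp only [← outerCLM_apply, map_add, add_apply]
    abel
  have hB : 0 ≤ B := (norm_nonneg _).trans hx
  rw [e]
  calc _ ≤ ‖outer x (d + w)‖ + ‖outer (d + w) x‖ + ‖outer d d‖ := norm_add₃_le
    _ ≤ ‖x‖ * ‖d + w‖ + ‖d + w‖ * ‖x‖ + ‖d‖ * ‖d‖ := by
        gcongr <;> exact norm_outer_le _ _
    _ ≤ B * ((4 * C + M * c) * ‖m'‖ ^ 2) + (4 * C + M * c) * ‖m'‖ ^ 2 * B +
        (2 * M * ‖m'‖) * (2 * M * ‖m'‖) := by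
        have := norm_nonneg (d + w)
        gcongr
        exact this.trans hdw
    _ = _ := by ring

variable {Ω : Type*} [MeasurableSpace Ω] {P : Measure Ω} [IsProbabilityMeasure P]
  {K : Set (EuclideanSpace ℝ (Fin N))} {x : Ω → EuclideanSpace ℝ (Fin N)}

theorem norm_integral_sub_one_le (h : IsLogExpansion R φ M L C) (hK : IsCompact K)
    (hx : AEMeasurable x P) (hxK : ∀ᵐ ω ∂P, x ω ∈ K) :
    ‖∫ ω, R (x ω) ∂P - 1‖ ≤ L * ∫ ω, ‖x ω‖ ∂P := by
  have hR : Integrable (fun ω => R (x ω)) P :=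
    integrable_comp_of_ae_mem_isCompact hK hx hxK h.lipschitz.continuous
  have hn : Integrable (fun ω => ‖x ω‖) P :=
    integrable_comp_of_ae_mem_isCompact hK hx hxK (f := fun z => ‖z‖) (by fun_prop)
  have e : ∫ ω, R (x ω) ∂P - 1 = ∫ ω, (R (x ω) - 1) ∂P := by
    rw [integral_sub hR (integrable_const _)]; simp
  rw [e, ← integral_const_mul]
  refine norm_integral_le_of_norm_le (hn.const_mul _) (.of_forall fun ω => ?_)
  have := h.lipschitz.norm_sub_le (x ω) 0
  rwa [h.zero, sub_zero] at this

theorem norm_integral_expansion_le (h : IsLogExpansion R φ M L C) (hK : IsCompact K)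
    (hx : AEMeasurable x P) (hxK : ∀ᵐ ω ∂P, x ω ∈ K) {ε ε' : EuclideanSpace ℝ (Fin N)}
    (hε : ‖ε‖ ≤ 1) :
    ‖∫ ω, φ ε (x ω) ∂P - ∫ ω, φ ε' (x ω) ∂P +
        Matrix.toEuclideanCLM (𝕜 := ℝ) (∫ ω, R (x ω) ∂P) (ε - ε')‖ ≤
      C * (‖ε‖ + ‖ε'‖) * ‖ε - ε'‖ := by
  have hR : Integrable (fun ω => R (x ω)) P :=
    integrable_comp_of_ae_mem_isCompact hK hx hxK h.lipschitz.continuous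
  have hφ : ∀ ε, Integrable (fun ω => φ ε (x ω)) P := fun ε =>
    integrable_comp_of_ae_mem_isCompact hK hx hxK (h.continuous ε)
  have hφφ : Integrable (fun ω => φ ε (x ω) - φ ε' (x ω)) P := (hφ ε).sub (hφ ε')
  have e := ContinuousLinearMap.integral_comp_comm (evalCLM (ε - ε')) hR
  rw [← evalCLM_apply, ← e, ← integral_sub (hφ ε) (hφ ε'),
    ← integral_add hφφ (ContinuousLinearMap.integrable_comp _ hR)]
  calc _ ≤ C * (‖ε‖ + ‖ε'‖) * ‖ε - ε'‖ * P.real Set.univ :=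
        norm_integral_le_of_norm_le_const (.of_forall fun ω => h.expansion ε ε' (x ω) hε)
    _ = _ := by simp

/-- Expansion of the covariance about a zero `ε` of the mean equation. -/
theorem norm_integral_outer_sub_le (h : IsLogExpansion R φ M L C) (hC : 0 ≤ C) (hK : IsCompact K)
    (hx : AEMeasurable x P) (hxK : ∀ᵐ ω ∂P, x ω ∈ K) {B c a : ℝ} (hB : ∀ z ∈ K, ‖z‖ ≤ B)
    {ε m' : EuclideanSpace ℝ (Fin N)} (hε : ‖ε‖ ≤ 1) (hεm : ‖ε‖ ≤ 2 * ‖m'‖)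
    (hm : ‖ε - m'‖ ≤ c * ‖m'‖ ^ 2) (hmean : ‖meanVec P x‖ ≤ a * ‖m'‖) :
    ‖∫ ω, outer (φ ε (x ω)) (φ ε (x ω)) ∂P - (covMatrix P x -
        symPart (∫ ω, outer (Matrix.toEuclideanCLM (𝕜 := ℝ) (R (x ω)) m') (x ω) ∂P))‖ ≤
      (2 * B * (4 * C + M * c) + 4 * M ^ 2 + a ^ 2) * ‖m'‖ ^ 2 := by
  have hRc : Continuous fun z => Matrix.toEuclideanCLM (𝕜 := ℝ) (R z) m' :=
    (evalCLM m').continuous.comp h.lipschitz.continuous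
  have i1 : Integrable (fun ω => outer (φ ε (x ω)) (φ ε (x ω))) P := by
    have := h.continuous ε
    exact integrable_comp_of_ae_mem_isCompact hK hx hxK
      (f := fun z => outerCLM (φ ε z) (φ ε z)) (by fun_prop)
  have i2 : Integrable (fun ω => outer (x ω) (x ω)) P :=
    integrable_comp_of_ae_mem_isCompact hK hx hxK (f := fun z => outerCLM z z) (by fun_prop)
  have i3 : Integrable
      (fun ω => outer (Matrix.toEuclideanCLM (𝕜 := ℝ) (R (x ω)) m') (x ω)) P :=
    integrable_comp_of_ae_mem_isCompact hK hx hxK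
      (f := fun z => outerCLM (Matrix.toEuclideanCLM (𝕜 := ℝ) (R z) m') z) (by fun_prop)
  have i4 : Integrable
      (fun ω => outer (x ω) (Matrix.toEuclideanCLM (𝕜 := ℝ) (R (x ω)) m')) P :=
    integrable_comp_of_ae_mem_isCompact hK hx hxK
      (f := fun z => outerCLM z (Matrix.toEuclideanCLM (𝕜 := ℝ) (R z) m')) (by fun_prop)
  have i34 : Integrable (fun ω => outer (Matrix.toEuclideanCLM (𝕜 := ℝ) (R (x ω)) m') (x ω) +
      outer (x ω) (Matrix.toEuclideanCLM (𝕜 := ℝ) (R (x ω)) m')) P := i3.add i4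
  have i234 : Integrable (fun ω => outer (x ω) (x ω) -
      (outer (Matrix.toEuclideanCLM (𝕜 := ℝ) (R (x ω)) m') (x ω) +
      outer (x ω) (Matrix.toEuclideanCLM (𝕜 := ℝ) (R (x ω)) m'))) P := i2.sub i34
  have hsym : symPart (∫ ω, outer (Matrix.toEuclideanCLM (𝕜 := ℝ) (R (x ω)) m') (x ω) ∂P) =
      ∫ ω, (outer (Matrix.toEuclideanCLM (𝕜 := ℝ) (R (x ω)) m') (x ω) +
        outer (x ω) (Matrix.toEuclideanCLM (𝕜 := ℝ) (R (x ω)) m')) ∂P := by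
    rw [integral_add i3 i4, symPart, ← transposeCLM_apply,
      ← ContinuousLinearMap.integral_comp_comm _ i3]
    congr 1
    refine integral_congr_ae (.of_forall fun ω => ?_)
    ext i j
    simp [transposeCLM_apply, outer, mul_comm]
  have hcov := integral_outer_self hK hx hxK
  have e : ∫ ω, outer (φ ε (x ω)) (φ ε (x ω)) ∂P - (covMatrix P x -
        symPart (∫ ω, outer (Matrix.toEuclideanCLM (𝕜 := ℝ) (R (x ω)) m') (x ω) ∂P)) =
      ∫ ω, (outer (φ ε (x ω)) (φ ε (x ω)) - (outer (x ω) (x ω) -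
        (outer (Matrix.toEuclideanCLM (𝕜 := ℝ) (R (x ω)) m') (x ω) +
          outer (x ω) (Matrix.toEuclideanCLM (𝕜 := ℝ) (R (x ω)) m')))) ∂P +
        outer (meanVec P x) (meanVec P x) := by
    rw [integral_sub i1 i234, integral_sub i2 i34, hsym, hcov]
    abel
  rw [e]
  have h1 : ‖∫ ω, (outer (φ ε (x ω)) (φ ε (x ω)) - (outer (x ω) (x ω) -
        (outer (Matrix.toEuclideanCLM (𝕜 := ℝ) (R (x ω)) m') (x ω) +
          outer (x ω) (Matrix.toEuclideanCLM (𝕜 := ℝ) (R (x ω)) m')))) ∂P‖ ≤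
      (2 * B * (4 * C + M * c) + 4 * M ^ 2) * ‖m'‖ ^ 2 := by
    refine (norm_integral_le_of_norm_le_const
      (C := (2 * B * (4 * C + M * c) + 4 * M ^ 2) * ‖m'‖ ^ 2) ?_).trans (by simp)
    filter_upwards [hxK] with ω hω
    exact h.norm_outer_sub_le hC (hB _ hω) hε hεm hm
  have h2 : ‖outer (meanVec P x) (meanVec P x)‖ ≤ a ^ 2 * ‖m'‖ ^ 2 := by
    calc _ ≤ ‖meanVec P x‖ * ‖meanVec P x‖ := norm_outer_le _ _
      _ ≤ (a * ‖m'‖) * (a * ‖m'‖) := by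
          have := norm_nonneg (meanVec P x)
          gcongr
          exact this.trans hmean
      _ = _ := by ring
  calc _ ≤ _ := norm_add_le _ _
    _ ≤ _ := add_le_add h1 h2
    _ = _ := by ring

end IsLogExpansion

theorem isUnit_and_norm_inv_le_of_norm_sub_one_le {N : ℕ} {A : Matrix (Fin N) (Fin N) ℝ}
    (hA : ‖A - 1‖ ≤ 1 / 2) : IsUnit A ∧ ‖A⁻¹‖ ≤ 2 := by
  have hu : IsUnit A := by
    have := isUnit_one_sub_of_norm_lt_one (x := 1 - A) (by rw [norm_sub_rev]; linarith)
    simpa using this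
  refine ⟨hu, ?_⟩
  have hdet := (Matrix.isUnit_iff_isUnit_det _).1 hu
  have h1 : ‖(1 : Matrix (Fin N) (Fin N) ℝ)‖ ≤ 1 := by
    rw [← Matrix.l2_opNorm_toEuclideanCLM, map_one]
    exact ContinuousLinearMap.norm_id_le
  have e : A⁻¹ = 1 - (A - 1) * A⁻¹ := by
    rw [sub_mul, Matrix.mul_nonsing_inv _ hdet, one_mul]; abel
  have h2 : ‖A⁻¹‖ ≤ 1 + 1 / 2 * ‖A⁻¹‖ := by
    calc ‖A⁻¹‖ = ‖1 - (A - 1) * A⁻¹‖ := by rw [← e]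
      _ ≤ ‖(1 : Matrix (Fin N) (Fin N) ℝ)‖ + ‖(A - 1) * A⁻¹‖ := norm_sub_le _ _
      _ ≤ 1 + ‖A - 1‖ * ‖A⁻¹‖ := add_le_add h1 (norm_mul_le _ _)
      _ ≤ _ := by gcongr
  linarith

theorem norm_toEuclideanCLM_apply_le_of_norm_sub_one_le {N : ℕ} {A : Matrix (Fin N) (Fin N) ℝ}
    (hA : ‖A - 1‖ ≤ 1 / 2) (v : EuclideanSpace ℝ (Fin N)) :
    ‖Matrix.toEuclideanCLM (𝕜 := ℝ) A v‖ ≤ 3 / 2 * ‖v‖ := by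
  have e : Matrix.toEuclideanCLM (𝕜 := ℝ) A v =
      Matrix.toEuclideanCLM (𝕜 := ℝ) (A - 1) v + v := by
    have h1 : Matrix.toEuclideanCLM (𝕜 := ℝ) (1 : Matrix (Fin N) (Fin N) ℝ) v = v := by
      rw [map_one]; rfl
    have h2 := (evalCLM v).map_sub A 1
    simp only [evalCLM_apply] at h2
    rw [h2, h1, sub_add_cancel]
  have h0 : ‖Matrix.toEuclideanCLM (n := Fin N) (𝕜 := ℝ) (A - 1)‖ ≤ 1 / 2 :=
    (Matrix.l2_opNorm_toEuclideanCLM (A - 1)).trans_le hA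
  have h1 := ContinuousLinearMap.le_of_opNorm_le _ h0 v
  rw [e]
  linarith [norm_add_le (Matrix.toEuclideanCLM (𝕜 := ℝ) (A - 1) v) v]

end

theorem mainTheorem1 {n N : ℕ} (G : MatrixLieGroup n N)
    (D : Set (EuclideanSpace ℝ (Fin N))) (hD : G.IsExpDomain D)
    (K : Set (EuclideanSpace ℝ (Fin N))) (hK : IsCompact K) (hKD : K ⊆ D) :
    ∃ δ > (0 : ℝ), ∃ r > (0 : ℝ), ∃ C > (0 : ℝ),
      ∀ (Ω : Type*) [MeasurableSpace Ω] (P : Measure Ω) [IsProbabilityMeasure P]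
        (x : Ω → EuclideanSpace ℝ (Fin N)), IsConcentrated K δ P x →
        ∀ (μ : G.carrier) (g : Ω → G.carrier), (∀ ω, g ω = μ * G.Exp (x ω)) →
          Integrable (fun ω => (G.leftJac (x ω))⁻¹) P ∧
          IsUnit (G.meanInvJac P x) ∧
          Integrable (fun ω => G.crossTerm (G.correctedMean P x) (x ω)) P ∧
          (∃! ε : EuclideanSpace ℝ (Fin N), ‖ε‖ < r ∧ G.IsGroupMean D P g (μ * G.Exp ε)) ∧
          ∀ ε : EuclideanSpace ℝ (Fin N), ‖ε‖ < r → G.IsGroupMean D P g (μ * G.Exp ε) →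
            ‖ε - G.correctedMean P x‖ ≤ C * ‖G.correctedMean P x‖ ^ 2 ∧
            Integrable (fun ω => outer (G.log D ((μ * G.Exp ε)⁻¹ * g ω))
              (G.log D ((μ * G.Exp ε)⁻¹ * g ω))) P ∧
            ‖G.groupCov D P g (μ * G.Exp ε) -
                (covMatrix P x -
                  symPart (∫ ω, G.crossTerm (G.correctedMean P x) (x ω) ∂P))‖
              ≤ C * ‖G.correctedMean P x‖ ^ 2 := by
  obtain ⟨R, φ, M, L, C, ρ, hC, hρ, h, hRJ, hφ⟩ := G.exists_isLogExpansion hD hK hKD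
  obtain ⟨B, hB⟩ := hK.exists_bound_of_continuousOn (f := fun z => z) continuousOn_id
  -- `r` makes the mean equation a contraction and keeps the perturbation inside the chart.
  obtain ⟨r, hr0, hr1, hrρ, hCr⟩ : ∃ r : ℝ, 0 < r ∧ r ≤ 1 ∧ r ≤ ρ ∧ 8 * C * r ≤ 1 := by
    refine ⟨min (min 1 ρ) (1 / (8 * (C + 1))), by positivity,
      (min_le_left _ _).trans (min_le_left _ _), (min_le_left _ _).trans (min_le_right _ _), ?_⟩
    calc 8 * C * min (min 1 ρ) (1 / (8 * (C + 1))) ≤ 8 * C * (1 / (8 * (C + 1))) := by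
          gcongr; exact min_le_right _ _
      _ ≤ 1 := by
          rw [mul_one_div, div_le_one (by positivity)]
          linarith
  obtain ⟨η, hη0, hηL⟩ : ∃ η : ℝ, 0 < η ∧ L * (3 * η) ≤ 1 / 2 := by
    refine ⟨1 / (8 * (L + 1)), by positivity, ?_⟩
    rw [mul_one_div, mul_div_assoc', div_le_div_iff₀ (by positivity) (by norm_num)]
    linarith [L.coe_nonneg]
  -- A mean and covariance of size `δ` force `𝔼 ‖x‖ ≤ 3 η`, which puts `⟨J_l⁻¹⟩` within `1 / 2` of
  -- the identity.
  obtain ⟨δ, hδ0, hδη, hδr, hδκ⟩ :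
      ∃ δ : ℝ, 0 < δ ∧ δ ≤ η ∧ 8 * δ ≤ r ∧ ‖traceCLM N‖ * δ / η ≤ η := by
    generalize hκ : ‖traceCLM N‖ = κ
    have hκ0 : 0 ≤ κ := by rw [← hκ]; exact norm_nonneg (traceCLM N)
    refine ⟨min (min η (r / 8)) (η ^ 2 / (κ + 1)), by positivity,
      (min_le_left _ _).trans (min_le_left _ _), ?_, ?_⟩
    · have : min (min η (r / 8)) (η ^ 2 / (κ + 1)) ≤ r / 8 :=
        (min_le_left _ _).trans (min_le_right _ _)
      linarith
    · rw [div_le_iff₀ hη0]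
      calc κ * min (min η (r / 8)) (η ^ 2 / (κ + 1)) ≤ (κ + 1) * (η ^ 2 / (κ + 1)) := by
            gcongr
            · linarith
            · exact min_le_right _ _
        _ = η * η := by field_simp
  obtain ⟨C₁, hC₁0, hC₁a, hC₁b⟩ : ∃ C₁ : ℝ, 0 < C₁ ∧ 8 * C ≤ C₁ ∧
      2 * B * (4 * C + M * (8 * C)) + 4 * M ^ 2 + (3 / 2) ^ 2 ≤ C₁ := by
    have h1 := le_max_left (8 * C) (2 * B * (4 * C + M * (8 * C)) + 4 * M ^ 2 + (3 / 2) ^ 2)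
    have h2 := le_max_right (8 * C) (2 * B * (4 * C + M * (8 * C)) + 4 * M ^ 2 + (3 / 2) ^ 2)
    exact ⟨_, by linarith, h1.trans (le_add_of_nonneg_right zero_le_one),
      h2.trans (le_add_of_nonneg_right zero_le_one)⟩
  refine ⟨δ, hδ0, r, hr0, C₁, hC₁0, ?_⟩
  intro Ω _ P _ x hx μ g hg
  have hxm := hx.aemeasurable
  have hxK := hx.ae_mem
  obtain ⟨A, hA⟩ : ∃ A, A = ∫ ω, R (x ω) ∂P := ⟨_, rfl⟩
  have hRae : (fun ω => R (x ω)) =ᵐ[P] fun ω => (G.leftJac (x ω))⁻¹ := by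
    filter_upwards [hxK] with ω hω using hRJ _ hω
  have hAJ : G.meanInvJac P x = A := hA ▸ (integral_congr_ae hRae).symm
  have hA1 : ‖A - 1‖ ≤ 1 / 2 := by
    rw [hA]
    refine (h.norm_integral_sub_one_le hK hxm hxK).trans ?_
    have h1 := integral_norm_le hK hxm hxK hη0
    have h2 : ‖traceCLM N‖ * ‖covMatrix P x‖ / η ≤ ‖traceCLM N‖ * δ / η := by
      gcongr; exact hx.norm_cov_le
    have h3 : ∫ ω, ‖x ω‖ ∂P ≤ 3 * η := by linarith [hx.norm_mean_le]
    calc L * ∫ ω, ‖x ω‖ ∂P ≤ L * (3 * η) := by gcongr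
      _ ≤ 1 / 2 := hηL
  obtain ⟨hAu, hAinv⟩ := isUnit_and_norm_inv_le_of_norm_sub_one_le hA1
  have hAdet := (Matrix.isUnit_iff_isUnit_det _).1 hAu
  obtain ⟨m', hm'⟩ : ∃ m', m' = G.correctedMean P x := ⟨_, rfl⟩
  rw [← hm']
  have hm'e : m' = Matrix.toEuclideanCLM (𝕜 := ℝ) A⁻¹ (meanVec P x) := by
    rw [hm', MatrixLieGroup.correctedMean, hAJ]; rfl
  have hAm' : Matrix.toEuclideanCLM (𝕜 := ℝ) A m' = meanVec P x := by
    rw [hm'e, Matrix.toEuclideanCLM_mul_apply, Matrix.mul_nonsing_inv _ hAdet, map_one]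
    rfl
  have hmean : ‖meanVec P x‖ ≤ 3 / 2 * ‖m'‖ :=
    hAm' ▸ norm_toEuclideanCLM_apply_le_of_norm_sub_one_le hA1 m'
  obtain ⟨f, hf⟩ : ∃ f : EuclideanSpace ℝ (Fin N) → EuclideanSpace ℝ (Fin N),
      ∀ ε, f ε = ∫ ω, φ ε (x ω) ∂P := ⟨_, fun _ => rfl⟩
  have hf0 : f 0 = meanVec P x := by
    rw [hf]; simp only [h.apply_zero]; rfl
  obtain ⟨hex, hest⟩ := existsUnique_zero_of_quadratic_remainder
    (A := Matrix.toEuclideanCLM (𝕜 := ℝ) A) (B := Matrix.toEuclideanCLM (𝕜 := ℝ) A⁻¹) (f := f)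
    (fun v => by
      rw [Matrix.toEuclideanCLM_mul_apply, Matrix.nonsing_inv_mul _ hAdet, map_one]; rfl)
    (fun v => by
      rw [Matrix.toEuclideanCLM_mul_apply, Matrix.mul_nonsing_inv _ hAdet, map_one]; rfl)
    hAinv hC hr0 hCr (by rw [hf0]; linarith [hx.norm_mean_le])
    (fun ε ε' hε _ => by
      rw [hf, hf, hA]; exact h.norm_integral_expansion_le hK hxm hxK (hε.trans hr1))
  rw [hf0, ← hm'e] at hest
  have hgφ : ∀ ε ω, ‖ε‖ < r → x ω ∈ K → (μ * G.Exp ε)⁻¹ * g ω = G.Exp (φ ε (x ω)) := by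
    intro ε ω hε hω
    rw [hg, (hφ ε _ (hε.le.trans hrρ) hω).2]
    group
  have hlog : ∀ ε, ‖ε‖ < r →
      (fun ω => G.log D ((μ * G.Exp ε)⁻¹ * g ω)) =ᵐ[P] fun ω => φ ε (x ω) := by
    intro ε hε
    filter_upwards [hxK] with ω hω
    rw [hgφ ε ω hε hω, G.log_Exp hD (hφ ε _ (hε.le.trans hrρ) hω).1]
  have hiff : ∀ ε, ‖ε‖ < r → (G.IsGroupMean D P g (μ * G.Exp ε) ↔ f ε = 0) := by
    intro ε hε
    have e : ∫ ω, G.log D ((μ * G.Exp ε)⁻¹ * g ω) ∂P = f ε :=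
      (integral_congr_ae (hlog ε hε)).trans (hf ε).symm
    refine ⟨fun hm => e.symm.trans hm.integral_eq_zero, fun h0 => ⟨?_, ?_, e.trans h0⟩⟩
    · filter_upwards [hxK] with ω hω
      exact ⟨_, (hφ ε _ (hε.le.trans hrρ) hω).1, (hgφ ε ω hε hω).symm⟩
    · exact (integrable_comp_of_ae_mem_isCompact hK hxm hxK (h.continuous ε)).congr
        (hlog ε hε).symm
  have hcross : (fun ω => outer (Matrix.toEuclideanCLM (𝕜 := ℝ) (R (x ω)) m') (x ω)) =ᵐ[P]
      fun ω => G.crossTerm m' (x ω) := by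
    filter_upwards [hxK] with ω hω
    rw [hRJ _ hω]; rfl
  refine ⟨?_, hAJ ▸ hAu, ?_, ?_, ?_⟩
  · exact (integrable_comp_of_ae_mem_isCompact hK hxm hxK h.lipschitz.continuous).congr hRae
  · have hRc : Continuous fun z => Matrix.toEuclideanCLM (𝕜 := ℝ) (R z) m' :=
      (evalCLM m').continuous.comp h.lipschitz.continuous
    exact (integrable_comp_of_ae_mem_isCompact hK hxm hxK
      (f := fun z => outerCLM (Matrix.toEuclideanCLM (𝕜 := ℝ) (R z) m') z)
      (by fun_prop)).congr hcross
  · exact (existsUnique_congr fun ε => and_congr_right fun hε => hiff ε hε).2 hex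
  · intro ε hε hmean'
    obtain ⟨h1, h2⟩ := hest ε hε ((hiff ε hε).1 hmean')
    have hout : (fun ω => outer (φ ε (x ω)) (φ ε (x ω))) =ᵐ[P]
        fun ω => outer (G.log D ((μ * G.Exp ε)⁻¹ * g ω)) (G.log D ((μ * G.Exp ε)⁻¹ * g ω)) := by
      filter_upwards [hlog ε hε] with ω hω
      rw [hω]
    refine ⟨h2.trans (by gcongr), ?_, ?_⟩
    · have := h.continuous ε
      exact (integrable_comp_of_ae_mem_isCompact hK hxm hxK
        (f := fun z => outerCLM (φ ε z) (φ ε z)) (by fun_prop)).congr hout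
    · rw [MatrixLieGroup.groupCov, ← integral_congr_ae hout, ← integral_congr_ae hcross]
      exact (h.norm_integral_outer_sub_le hC hK hxm hxK hB (hε.le.trans hr1) h1 h2 hmean).trans
        (by gcongr)
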